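/- Let $K$ be a field of characteristic $0$ (for example $\mathbb{Q}$ or $\mathbb{C}$), let $\mathfrak{sl}_2$ be the Lie algebra of traceless $2\times 2$ matrices over $K$, with standard basis $\mathfrak{e}_+=\begin{pmatrix}0&1\\0&0\end{pmatrix}$, $\mathfrak{h}=\begin{pmatrix}1&0\\0&-1\end{pmatrix}$, $\mathfrak{e}_-=\begin{pmatrix}0&0\\1&0\end{pmatrix}$, and let $n,d\ge 0$ be integers. Let $V_d$ be the standard $(d+1)$-dimensional $\mathfrak{sl}_2$-module, with basis $v_0,\dots,v_d$ and action $$\mathfrak{e}_+v_i=(d-i)v_{i+1},\qquad \mathfrak{h}v_i=(2i-d)v_i,\qquad \mathfrak{e}_-v_i=i\,v_{i-1}.$$ Let $\mathfrak{sl}_2$ act on $K[x_1,\dots,x_n]$ by $$\rho_2(\mathfrak{e}_+)=\sum_{k=1}^n\left(-x_k^2\partial_k+d\,x_k\right),\qquad \rho_2(\mathfrak{h})=2\sum_{k=1}^n x_k\partial_k-nd,\qquad \rho_2(\mathfrak{e}_-)=\sum_{k=1}^n\partial_k,$$ where $\partial_k=\partial/\partial x_k$, and let $\Lambda_n^{(d)}$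 be the $\mathfrak{sl}_2$-submodule of all symmetric polynomials of degree at most $d$ in each variable. Let $\mathrm{Sym}^n(V_d)$ be the degree $n$ component of the symmetric algebra of $V_d$, on which $\mathfrak{sl}_2$ acts by derivations. For $q\in\mathbb{Q}$ let $p(d,n,q)$ be the number of partitions of $q$ into at most $n$ parts, each at most $d$ (that is, partitions of size $q$ inside a $d\times n$ rectangle), which is $0$ unless $q$ is a nonnegative integer, and put $$c_n(d,i)=p\left(d,n,\tfrac12 dn-\tfrac12 i\right)-p\left(d,n,\tfrac12 dn-\tfrac12 i-1\right).$$ Then, as $\mathfrak{sl}_2$-modules, $$\Lambda_n^{(d)}\cong \mathrm{Sym}^n(V_d),$$ the integers $c_n(d,i)$, $0\le i\le nd$, are nonnegative, and $$\Lambda_n^{(d)}\cong\bigoplus_{i=0}^{nd}c_n(d,i)\,V_i ,$$ where $c_n(d,i)\,V_i$ is the direct sum of $c_n(d,i)$ copies of $V_i$. -/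

import Mathlib

open scoped DirectSum

noncomputable section

namespace SlTwo

section

attribute [local instance] LieRing.ofAssociativeRing

/-! ### The Lie algebra `sl₂` and its representations -/

/-- `sl₂` over `K`: the Lie algebra of traceless `2 × 2` matrices. -/
abbrev Sl2 (K : Type*) [Field K] : Type _ := LieAlgebra.SpecialLinear.sl (Fin 2) K

/-- The representation of `sl₂` on `M` with `e₊ = !![0, 1; 0, 0] ↦ e`, `h = !![1, 0; 0, -1] ↦ h`,
`e₋ = !![0, 0; 1, 0] ↦ f`, for operators satisfying the commutation relations of `sl₂`. -/
def sl2Rep {K M : Type*} [Field K] [AddCommGroup M] [Module K M] (e h f : Module.End K M)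
    (he : ⁅h, e⁆ = (2 : K) • e) (hf : ⁅h, f⁆ = (-2 : K) • f) (hef : ⁅e, f⁆ = h) :
    Sl2 K →ₗ⁅K⁆ Module.End K M where
  toFun A := A.1 0 1 • e + A.1 0 0 • h + A.1 1 0 • f
  map_add' A B := by
    have hAB : (A + B).1 = A.1 + B.1 := rfl
    simp only [hAB, Matrix.add_apply, add_smul]
    abel
  map_smul' c A := by
    have hcA : (c • A).1 = c • A.1 := rfl
    simp only [hcA, Matrix.smul_apply, smul_eq_mul, RingHom.id_apply, smul_add, smul_smul]
  map_lie' {A B} := by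
    have hA : A.1 1 1 = - A.1 0 0 := by
      have := LinearMap.mem_ker.1 A.2
      rw [Matrix.traceLinearMap_apply, Matrix.trace_fin_two] at this
      linear_combination this
    have hB : B.1 1 1 = - B.1 0 0 := by
      have := LinearMap.mem_ker.1 B.2
      rw [Matrix.traceLinearMap_apply, Matrix.trace_fin_two] at this
      linear_combination this
    have he' : ⁅e, h⁆ = -((2 : K) • e) := by rw [← lie_skew, he]
    have hf' : ⁅f, h⁆ = -((-2 : K) • f) := by rw [← lie_skew, hf]
    have hfe : ⁅f, e⁆ = -h := by rw [← lie_skew, hef]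
    simp only [LieAlgebra.SpecialLinear.sl_bracket, Matrix.sub_apply, Matrix.mul_apply,
      Fin.sum_univ_two, hA, hB, lie_add, add_lie, lie_smul, smul_lie, lie_self, he, hf, hef,
      he', hf', hfe]
    module

/-! ### The standard module `V_d` -/

/-- The space `V_d` with basis `v_0, …, v_d`. -/
def V (K : Type*) (d : ℕ) : Type _ := Fin (d + 1) → K

namespace V

variable (K : Type*) [Field K] (d : ℕ)

instance : AddCommGroup (V K d) := inferInstanceAs (AddCommGroup (Fin (d + 1) → K))
instance : Module K (V K d) := inferInstanceAs (Module K (Fin (d + 1) → K))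

/-- The basis `v_0, …, v_d`. -/
def basis : Module.Basis (Fin (d + 1)) K (V K d) := Pi.basisFun K (Fin (d + 1))

/-- The vector `v_k`, with the convention `v_k = 0` for `k > d`. -/
def vec (k : ℕ) : V K d := if hk : k < d + 1 then basis K d ⟨k, hk⟩ else 0

/-- `e₊ v_i = (d - i) v_{i+1}`. -/
def e : Module.End K (V K d) :=
  (basis K d).constr K fun i => ((d : K) - ((i : ℕ) : K)) • vec K d (i + 1)

/-- `h v_i = (2 i - d) v_i`. -/
def h : Module.End K (V K d) :=
  (basis K d).constr K fun i => (2 * ((i : ℕ) : K) - (d : K)) • vec K d i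

/-- `e₋ v_i = i v_{i-1}` (which is `0` for `i = 0`). -/
def f : Module.End K (V K d) :=
  (basis K d).constr K fun i => ((i : ℕ) : K) • vec K d (i - 1)

lemma basis_eq (i : Fin (d + 1)) : basis K d i = vec K d i := by
  rw [vec, dif_pos i.2]

lemma vec_of_lt {k : ℕ} (hk : d < k) : vec K d k = 0 := by
  rw [vec, dif_neg (by omega)]

lemma e_vec (k : ℕ) : e K d (vec K d k) = ((d : K) - (k : K)) • vec K d (k + 1) := by
  by_cases hk : k < d + 1
  · rw [← basis_eq K d ⟨k, hk⟩, e, Module.Basis.constr_basis]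
  · rw [vec_of_lt K d (by omega), vec_of_lt K d (by omega), map_zero, smul_zero]

lemma h_vec (k : ℕ) : h K d (vec K d k) = (2 * (k : K) - (d : K)) • vec K d k := by
  by_cases hk : k < d + 1
  · rw [← basis_eq K d ⟨k, hk⟩, h, Module.Basis.constr_basis, basis_eq]
  · rw [vec_of_lt K d (by omega), map_zero, smul_zero]

lemma f_vec {k : ℕ} (hk : k < d + 1) : f K d (vec K d k) = (k : K) • vec K d (k - 1) := by
  rw [← basis_eq K d ⟨k, hk⟩, f, Module.Basis.constr_basis]

lemma lie_h_e : ⁅h K d, e K d⁆ = (2 : K) • e K d := by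
  refine (basis K d).ext fun i => ?_
  simp only [basis_eq, LieRing.of_associative_ring_bracket, LinearMap.sub_apply,
    Module.End.mul_apply, LinearMap.smul_apply, e_vec, h_vec, map_smul]
  push_cast
  module

lemma lie_h_f : ⁅h K d, f K d⁆ = (-2 : K) • f K d := by
  refine (basis K d).ext fun ⟨i, hi⟩ => ?_
  simp only [basis_eq, LieRing.of_associative_ring_bracket, LinearMap.sub_apply,
    Module.End.mul_apply, LinearMap.smul_apply, f_vec K d hi, h_vec, map_smul]
  cases i with
  | zero => simp
  | succ i =>
    simp only [Nat.add_sub_cancel]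
    push_cast
    module

lemma lie_e_f : ⁅e K d, f K d⁆ = h K d := by
  refine (basis K d).ext fun ⟨i, hi⟩ => ?_
  have h1 : f K d (e K d (vec K d i)) = (((d : K) - i) * (i + 1)) • vec K d i := by
    rw [e_vec, map_smul]
    by_cases hd : i = d
    · simp [hd]
    · rw [f_vec K d (by omega)]
      simp [smul_smul]
  have h2 : e K d (f K d (vec K d i)) = ((i : K) * ((d : K) - i + 1)) • vec K d i := by
    rw [f_vec K d hi, map_smul, e_vec]
    cases i with
    | zero => simp
    | succ i =>
      simp only [Nat.add_sub_cancel, smul_smul]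
      push_cast
      congr 1
      ring
  simp only [basis_eq, LieRing.of_associative_ring_bracket, LinearMap.sub_apply,
    Module.End.mul_apply, h1, h2, h_vec]
  module

/-- The representation of `sl₂` on `V_d`. -/
def rep : Sl2 K →ₗ⁅K⁆ Module.End K (V K d) :=
  sl2Rep (e K d) (h K d) (f K d) (lie_h_e K d) (lie_h_f K d) (lie_e_f K d)

instance : LieRingModule (Sl2 K) (V K d) := LieRingModule.compLieHom (V K d) (rep K d)
instance : LieModule K (Sl2 K) (V K d) := LieModule.compLieHom (V K d) (rep K d)

end V

/-! ### The symmetric algebra of a Lie module -/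

section Sym

variable {K M : Type*} [Field K] [AddCommGroup M] [Module K M]

/-- The algebra map `a ↦ a + ε D(a)` where `D` is the derivation extending `φ`. -/
def symDerAux (φ : Module.End K M) :
    SymmetricAlgebra K M →ₐ[K] DualNumber (SymmetricAlgebra K M) :=
  SymmetricAlgebra.lift
    ((TrivSqZeroExt.inlAlgHom K (SymmetricAlgebra K M) (SymmetricAlgebra K M)).toLinearMap ∘ₗ
        SymmetricAlgebra.ι K M +
      (TrivSqZeroExt.inrHom (SymmetricAlgebra K M) (SymmetricAlgebra K M)).restrictScalars K ∘ₗ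
        SymmetricAlgebra.ι K M ∘ₗ φ)

lemma fst_symDerAux (φ : Module.End K M) (a : SymmetricAlgebra K M) :
    (symDerAux φ a).fst = a := by
  have : (TrivSqZeroExt.fstHom K (SymmetricAlgebra K M) (SymmetricAlgebra K M)).comp
      (symDerAux φ) = AlgHom.id K (SymmetricAlgebra K M) := by
    refine SymmetricAlgebra.algHom_ext (LinearMap.ext fun x => ?_)
    simp [symDerAux]
  exact DFunLike.congr_fun this a

/-- The derivation of the symmetric algebra of `M` extending the endomorphism `φ` of `M`. -/
def symDer (φ : Module.End K M) :
    Derivation K (SymmetricAlgebra K M) (SymmetricAlgebra K M) :=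
  Derivation.mk'
    ((TrivSqZeroExt.sndHom (SymmetricAlgebra K M) (SymmetricAlgebra K M)).restrictScalars K ∘ₗ
      (symDerAux φ).toLinearMap)
    (fun a b => by simp [fst_symDerAux, mul_comm])

@[simp] lemma symDer_ι (φ : Module.End K M) (x : M) :
    symDer φ (SymmetricAlgebra.ι K M x) = SymmetricAlgebra.ι K M (φ x) := by
  simp [symDer, symDerAux]

lemma symDer_ext {D D' : Derivation K (SymmetricAlgebra K M) (SymmetricAlgebra K M)}
    (hD : ∀ x, D (SymmetricAlgebra.ι K M x) = D' (SymmetricAlgebra.ι K M x)) : D = D' := by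
  refine Derivation.ext fun a => ?_
  induction a using SymmetricAlgebra.induction with
  | algebraMap r => simp
  | ι x => exact hD x
  | mul a b ha hb => simp [ha, hb]
  | add a b ha hb => simp [ha, hb]

variable {L : Type*} [LieRing L] [LieAlgebra K L] [LieRingModule L M] [LieModule K L M]

/-- A Lie algebra acting on `M` acts on the symmetric algebra of `M` by derivations. -/
instance : LieRingModule L (SymmetricAlgebra K M) where
  bracket x a := symDer (LieModule.toEnd K L M x) a
  add_lie x y a := by
    rw [← Derivation.add_apply]
    exact DFunLike.congr_fun (symDer_ext fun v => by simp) a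
  lie_add x a b := map_add _ a b
  leibniz_lie x y a := by
    have : ⁅symDer (LieModule.toEnd K L M x), symDer (LieModule.toEnd K L M y)⁆ =
        symDer (LieModule.toEnd K L M ⁅x, y⁆) :=
      symDer_ext fun v => by simp [Derivation.commutator_apply]
    change _ = symDer (LieModule.toEnd K L M ⁅x, y⁆) a + _
    rw [← this, Derivation.commutator_apply]
    abel

lemma lie_symmetricAlgebra (x : L) (a : SymmetricAlgebra K M) :
    ⁅x, a⁆ = symDer (LieModule.toEnd K L M x) a := rfl

instance : LieModule K L (SymmetricAlgebra K M) where
  smul_lie t x a := by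
    simp only [lie_symmetricAlgebra]
    rw [← Derivation.smul_apply]
    exact DFunLike.congr_fun (symDer_ext fun v => by simp) a
  lie_smul t x a := (symDer (LieModule.toEnd K L M x)).map_smul t a

variable (K L M)

/-- The `n`-th symmetric power of `M`: the degree `n` component of the symmetric algebra, that is,
the span of the products of `n` elements of `M`. -/
def symPower (n : ℕ) : LieSubmodule K L (SymmetricAlgebra K M) where
  __ := (LinearMap.range (SymmetricAlgebra.ι K M)) ^ n
  lie_mem {x a} ha := by
    change a ∈ (LinearMap.range (SymmetricAlgebra.ι K M)) ^ n at ha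
    change ⁅x, a⁆ ∈ (LinearMap.range (SymmetricAlgebra.ι K M)) ^ n
    rw [lie_symmetricAlgebra]
    induction n generalizing a with
    | zero =>
      rw [pow_zero, Submodule.mem_one] at ha
      obtain ⟨r, rfl⟩ := ha
      simp
    | succ n ih =>
      rw [pow_succ] at ha ⊢
      induction ha using Submodule.mul_induction_on' with
      | mem_mul_mem a ha b hb =>
        obtain ⟨v, rfl⟩ := hb
        rw [Derivation.leibniz, symDer_ι, smul_eq_mul, smul_eq_mul,
          mul_comm (SymmetricAlgebra.ι K M v)]
        exact add_mem (Submodule.mul_mem_mul ha (LinearMap.mem_range_self _ _))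
          (Submodule.mul_mem_mul (ih ha) (LinearMap.mem_range_self _ _))
      | add a _ b _ ha hb =>
        rw [map_add]
        exact add_mem ha hb

end Sym

/-! ### The second action on polynomials -/

section Poly

variable (K : Type*) [Field K] (n d : ℕ)

open MvPolynomial

/-- `ρ₂(e₊) = ∑ₖ (- xₖ² ∂ₖ + d xₖ)`. -/
def polyE : Module.End K (MvPolynomial (Fin n) K) :=
  ∑ k : Fin n, (-(LinearMap.mulLeft K (X k ^ 2) ∘ₗ (pderiv k).toLinearMap) +
    (d : K) • LinearMap.mulLeft K (X k))

/-- `ρ₂(h) = 2 ∑ₖ xₖ ∂ₖ - n d`. -/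
def polyH : Module.End K (MvPolynomial (Fin n) K) :=
  (2 : K) • ∑ k : Fin n, LinearMap.mulLeft K (X k) ∘ₗ (pderiv k).toLinearMap -
    ((n : K) * (d : K)) • LinearMap.id

/-- `ρ₂(e₋) = ∑ₖ ∂ₖ`. -/
def polyF : Module.End K (MvPolynomial (Fin n) K) :=
  ∑ k : Fin n, (pderiv k).toLinearMap

lemma polyE_apply (p : MvPolynomial (Fin n) K) :
    polyE K n d p = ∑ k : Fin n, (-(X k ^ 2 * pderiv k p) + (d : K) • (X k * p)) := by
  simp [polyE]

lemma polyH_apply (p : MvPolynomial (Fin n) K) :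
    polyH K n d p = (2 : K) • ∑ k : Fin n, X k * pderiv k p - ((n : K) * (d : K)) • p := by
  simp [polyH]

lemma polyF_apply (p : MvPolynomial (Fin n) K) :
    polyF K n p = ∑ k : Fin n, pderiv k p := by
  simp [polyF]

lemma polyE_monomial (m : Fin n →₀ ℕ) (c : K) :
    polyE K n d (monomial m c) =
      ∑ k : Fin n, monomial (m + Finsupp.single k 1) (((d : K) - (m k : K)) * c) := by
  rw [polyE_apply]
  refine Finset.sum_congr rfl fun k _ => ?_
  have h1 : X k * pderiv k (monomial m c) = (m k : K) • monomial m c := by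
    rw [X_mul_pderiv_monomial, Nat.cast_smul_eq_nsmul]
  have h2 : X k * monomial m c = monomial (m + Finsupp.single k 1) c := by
    rw [X, monomial_mul, one_mul, add_comm]
  rw [pow_two, mul_assoc, h1, mul_smul_comm, h2, ← map_smul, ← map_smul, ← map_neg, ← map_add]
  congr 1
  simp only [smul_eq_mul]
  ring

lemma polyH_monomial (m : Fin n →₀ ℕ) (c : K) :
    polyH K n d (monomial m c) =
      (2 * (∑ k : Fin n, (m k : K)) - (n : K) * (d : K)) • monomial m c := by
  rw [polyH_apply]
  simp only [X_mul_pderiv_monomial]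
  simp only [← Nat.cast_smul_eq_nsmul K, ← Finset.sum_smul]
  module

lemma polyF_monomial (m : Fin n →₀ ℕ) (c : K) :
    polyF K n (monomial m c) =
      ∑ k : Fin n, monomial (m - Finsupp.single k 1) (c * (m k : K)) := by
  rw [polyF_apply]
  simp only [pderiv_monomial]

lemma pderiv_comm (k l : Fin n) (p : MvPolynomial (Fin n) K) :
    pderiv k (pderiv l p) = pderiv l (pderiv k p) := by
  have : ⁅(pderiv k : Derivation K (MvPolynomial (Fin n) K) (MvPolynomial (Fin n) K)),
      (pderiv l : Derivation K (MvPolynomial (Fin n) K) (MvPolynomial (Fin n) K))⁆ = 0 := by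
    refine MvPolynomial.derivation_ext fun i => ?_
    rw [Derivation.commutator_apply]
    by_cases h1 : i = k <;> by_cases h2 : i = l <;>
      simp [pderiv_X, Pi.single_apply, h1, h2]
    all_goals split_ifs <;> simp
  have h := DFunLike.congr_fun this p
  rw [Derivation.commutator_apply] at h
  exact sub_eq_zero.1 h

lemma lie_polyE_polyF : ⁅polyE K n d, polyF K n⁆ = polyH K n d := by
  refine LinearMap.ext fun p => ?_
  have key (k l : Fin n) :
      pderiv l (-(X k ^ 2 * pderiv k p) + (d : K) • (X k * p)) =
        -(X k ^ 2 * pderiv k (pderiv l p)) + (d : K) • (X k * pderiv l p) +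
          if k = l then -((2 : K) • (X k * pderiv k p)) + (d : K) • p else 0 := by
    rw [pderiv_comm K n k l]
    split_ifs with hkl
    · subst hkl
      simp only [map_add, map_neg, Derivation.leibniz, Derivation.leibniz_pow,
        pderiv_X_self, smul_eq_mul, Derivation.map_smul, two_smul]
      simp only [smul_add, mul_one]
      ring
    · simp only [map_add, map_neg, Derivation.leibniz, Derivation.map_smul,
        Derivation.leibniz_pow, pderiv_X_of_ne hkl, smul_eq_mul]
      simp
  rw [LieRing.of_associative_ring_bracket, LinearMap.sub_apply, Module.End.mul_apply,
    Module.End.mul_apply, polyF_apply, polyE_apply, polyE_apply, polyF_apply, polyH_apply]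
  simp only [map_sum, key]
  rw [Finset.sum_comm]
  simp only [Finset.sum_add_distrib, Finset.mul_sum, Finset.smul_sum, Finset.sum_neg_distrib,
    Finset.sum_ite_eq, Finset.mem_univ, if_true, Finset.sum_const, Finset.card_univ,
    Fintype.card_fin]
  rw [Finset.sum_comm (f := fun x i => X x ^ 2 * (pderiv x) ((pderiv i) p)),
    Finset.sum_comm (f := fun x i => (d : K) • (X x * (pderiv i) p)), ← Nat.cast_smul_eq_nsmul K]
  module

lemma lie_polyH_polyE : ⁅polyH K n d, polyE K n d⁆ = (2 : K) • polyE K n d := by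
  refine MvPolynomial.linearMap_ext fun m => LinearMap.ext fun c => ?_
  simp only [LinearMap.comp_apply, LieRing.of_associative_ring_bracket, LinearMap.sub_apply,
    Module.End.mul_apply, LinearMap.smul_apply, polyH_monomial, map_smul]
  simp only [polyE_monomial, map_sum, polyH_monomial, Finset.smul_sum, ← Finset.sum_sub_distrib]
  refine Finset.sum_congr rfl fun k _ => ?_
  rw [← sub_smul]
  congr 1
  simp only [Finsupp.add_apply, Nat.cast_add, Finset.sum_add_distrib, Finsupp.single_apply,
    Nat.cast_ite, Nat.cast_one, Nat.cast_zero, Finset.sum_ite_eq, Finset.mem_univ, if_true]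
  ring

lemma lie_polyH_polyF : ⁅polyH K n d, polyF K n⁆ = (-2 : K) • polyF K n := by
  refine MvPolynomial.linearMap_ext fun m => LinearMap.ext fun c => ?_
  simp only [LinearMap.comp_apply, LieRing.of_associative_ring_bracket, LinearMap.sub_apply,
    Module.End.mul_apply, LinearMap.smul_apply, polyH_monomial, map_smul]
  simp only [polyF_monomial, map_sum, polyH_monomial, Finset.smul_sum, ← Finset.sum_sub_distrib]
  refine Finset.sum_congr rfl fun k _ => ?_
  by_cases hk : m k = 0
  · simp [hk]
  obtain ⟨m', rfl⟩ : ∃ m', m = m' + Finsupp.single k 1 :=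
    ⟨m - Finsupp.single k 1, (tsub_add_cancel_of_le
      (Finsupp.single_le_iff.2 (Nat.one_le_iff_ne_zero.2 hk))).symm⟩
  rw [← sub_smul, add_tsub_cancel_right]
  congr 1
  simp only [Finsupp.add_apply, Nat.cast_add, Finset.sum_add_distrib, Finsupp.single_apply,
    Nat.cast_ite, Nat.cast_one, Nat.cast_zero, Finset.sum_ite_eq, Finset.mem_univ, if_true]
  ring

/-- The space `K[x₁, …, xₙ]`, on which `sl₂` acts by `ρ₂` with parameter `d`. -/
def Poly (K : Type*) [Field K] (n _d : ℕ) : Type _ := MvPolynomial (Fin n) K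

instance : AddCommGroup (Poly K n d) := inferInstanceAs (AddCommGroup (MvPolynomial (Fin n) K))
instance : Module K (Poly K n d) := inferInstanceAs (Module K (MvPolynomial (Fin n) K))

/-- The representation `ρ₂` of `sl₂` on `K[x₁, …, xₙ]` with parameter `d`. -/
def rho2 : Sl2 K →ₗ⁅K⁆ Module.End K (Poly K n d) :=
  sl2Rep (M := Poly K n d) (polyE K n d) (polyH K n d) (polyF K n)
    (lie_polyH_polyE K n d) (lie_polyH_polyF K n d) (lie_polyE_polyF K n d)

instance : LieRingModule (Sl2 K) (Poly K n d) :=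
  LieRingModule.compLieHom (Poly K n d) (rho2 K n d)
instance : LieModule K (Sl2 K) (Poly K n d) :=
  LieModule.compLieHom (Poly K n d) (rho2 K n d)

/-- The space of symmetric polynomials in `n` variables, of degree at most `d` in each variable. -/
def symPolySubmodule : Submodule K (MvPolynomial (Fin n) K) where
  carrier := {p | p.IsSymmetric ∧ ∀ i, p.degreeOf i ≤ d}
  zero_mem' := ⟨MvPolynomial.IsSymmetric.zero, by simp⟩
  add_mem' hp hq := ⟨hp.1.add hq.1, fun i =>
    (degreeOf_add_le i _ _).trans (max_le (hp.2 i) (hq.2 i))⟩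
  smul_mem' c p hp := ⟨hp.1.smul c, fun i => by
    rw [smul_eq_C_mul]
    exact (degreeOf_C_mul_le p i c).trans (hp.2 i)⟩

variable {K n d}

lemma degreeOf_map_le {T : Module.End K (MvPolynomial (Fin n) K)}
    (hT : ∀ (m : Fin n →₀ ℕ) (c : K), (∀ i, m i ≤ d) → ∀ i, (T (monomial m c)).degreeOf i ≤ d)
    {p : MvPolynomial (Fin n) K} (hp : ∀ i, p.degreeOf i ≤ d) (i : Fin n) :
    (T p).degreeOf i ≤ d := by
  rw [p.as_sum, map_sum]
  refine (degreeOf_sum_le i _ _).trans (Finset.sup_le fun m hm => hT m _ (fun j => ?_) i)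
  exact (monomial_le_degreeOf j hm).trans (hp j)

lemma degreeOf_monomial_le {m : Fin n →₀ ℕ} {c : K} (hm : c ≠ 0 → ∀ i, m i ≤ d) (i : Fin n) :
    (monomial m c).degreeOf i ≤ d := by
  by_cases hc : c = 0
  · simp [hc]
  · rw [degreeOf_monomial_eq m i hc]
    exact hm hc i

lemma polyE_mem {p : MvPolynomial (Fin n) K} (hp : p ∈ symPolySubmodule K n d) :
    polyE K n d p ∈ symPolySubmodule K n d := by
  refine ⟨fun σ => ?_, degreeOf_map_le (fun m c hm i => ?_) hp.2⟩
  · simp only [polyE_apply, map_sum, map_add, map_neg, map_mul, map_smul, map_pow, rename_X,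
      ← pderiv_rename σ.injective, hp.1 σ]
    exact Equiv.sum_comp σ (fun k => -(X k ^ 2 * pderiv k p) + (d : K) • (X k * p))
  · rw [polyE_monomial]
    refine (degreeOf_sum_le i _ _).trans (Finset.sup_le fun k _ =>
      degreeOf_monomial_le (fun hc j => ?_) i)
    have hk : m k ≠ d := by
      rintro hk
      simp [hk] at hc
    have := hm j
    have := hm k
    by_cases hjk : k = j
    · subst hjk
      simp
      omega
    · simpa [hjk] using hm j

lemma polyH_mem {p : MvPolynomial (Fin n) K} (hp : p ∈ symPolySubmodule K n d) :
    polyH K n d p ∈ symPolySubmodule K n d := by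
  refine ⟨fun σ => ?_, degreeOf_map_le (fun m c hm i => ?_) hp.2⟩
  · simp only [polyH_apply, map_sum, map_sub, map_mul, map_smul, rename_X,
      ← pderiv_rename σ.injective, hp.1 σ]
    congr 2
    exact Equiv.sum_comp σ (fun k => X k * pderiv k p)
  · rw [polyH_monomial, smul_monomial]
    exact degreeOf_monomial_le (fun _ => hm) i

lemma polyF_mem {p : MvPolynomial (Fin n) K} (hp : p ∈ symPolySubmodule K n d) :
    polyF K n p ∈ symPolySubmodule K n d := by
  refine ⟨fun σ => ?_, degreeOf_map_le (fun m c hm i => ?_) hp.2⟩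
  · simp only [polyF_apply, map_sum, ← pderiv_rename σ.injective, hp.1 σ]
    exact Equiv.sum_comp σ (fun k => pderiv k p)
  · rw [polyF_monomial]
    refine (degreeOf_sum_le i _ _).trans (Finset.sup_le fun k _ =>
      degreeOf_monomial_le (fun _ j => ?_) i)
    rw [Finsupp.tsub_apply]
    exact (Nat.sub_le _ _).trans (hm j)

variable (K n d)

/-- `Λ_n^{(d)}`: the symmetric polynomials in `n` variables of degree at most `d` in each variable,
as an `sl₂`-submodule for the action `ρ₂`. -/
def symPoly : LieSubmodule K (Sl2 K) (Poly K n d) where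
  __ := (symPolySubmodule K n d : Submodule K (Poly K n d))
  lie_mem {A p} hp := by
    change p ∈ symPolySubmodule K n d at hp
    exact add_mem (add_mem (Submodule.smul_mem _ _ (polyE_mem hp))
      (Submodule.smul_mem _ _ (polyH_mem hp))) (Submodule.smul_mem _ _ (polyF_mem hp))

end Poly

end

/-! ### The multiplicities -/

/-- The number of partitions of `q` whose Young diagram fits inside a `d × n` rectangle (at most `n`
parts, each at most `d`). It is `0` unless `q` is a nonnegative integer. -/
def boxPartitions (d n : ℕ) (q : ℚ) : ℕ :=
  if q = (⌊q⌋₊ : ℚ) then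
    (Finset.univ.filter fun p : Nat.Partition ⌊q⌋₊ =>
      p.parts.card ≤ n ∧ ∀ x ∈ p.parts, x ≤ d).card
  else 0

/-- The number `c_n(d, i)` given by the Cayley–Sylvester formula. -/
def c (n d i : ℕ) : ℤ :=
  (boxPartitions d n ((d : ℚ) * n / 2 - i / 2) : ℤ) -
    boxPartitions d n ((d : ℚ) * n / 2 - i / 2 - 1)

end SlTwo

end

/-! Both modules have a basis of weight vectors indexed by the multisets of `n` elements of `{0, …,
d}`: products of the `v_i` in `Sym^n(V_d)`, monomial symmetric polynomials in `Λ_n^{(d)}`. In both,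
the multiset `s` has weight `2 ∑ s - n d`, so the weight multiplicities agree. Dropping zeros turns
these multisets into partitions in the `d × n` box, hence `c_n(d, i) = dim M_{-i} - dim M_{-i-2}`
for either module `M`.

It remains to see that such multiplicities determine `M` (`decomposition`), and this is done without
complete reducibility. By rank-nullity the kernel of `e₋ : M_{-i} → M_{-i-2}` has dimension at least
`c_i`, so one can choose `max(c_i, 0)` independent lowest weight vectors there. Each defines a
morphism `V_i → M` (`V.ofLowest`), and together they form an injective morphism
(`ofLowests_injective`). Therefore `∑ max(c_i, 0) (i + 1) ≤ dim M`. Summation by parts and the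
symmetry `w ↔ -w` of the multiplicities give `dim M = ∑ c_i (i + 1)` (`sum_sub_mul_eq`). Equality is
thus forced in every term: all `c_i` are nonnegative, and the injection is bijective. -/

noncomputable section

namespace SlTwo

/-! ### The standard basis of `sl₂` -/

section Triple

variable (K : Type*) [Field K]

/-- The matrix `!![0, 1; 0, 0]`. -/
def elE : Sl2 K := ⟨!![0, 1; 0, 0], by simp [LieAlgebra.SpecialLinear.sl, LinearMap.mem_ker,
  Matrix.trace_fin_two]⟩

/-- The matrix `!![1, 0; 0, -1]`. -/
def elH : Sl2 K := ⟨!![1, 0; 0, -1], by simp [LieAlgebra.SpecialLinear.sl, LinearMap.mem_ker,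
  Matrix.trace_fin_two]⟩

/-- The matrix `!![0, 0; 1, 0]`. -/
def elF : Sl2 K := ⟨!![0, 0; 1, 0], by simp [LieAlgebra.SpecialLinear.sl, LinearMap.mem_ker,
  Matrix.trace_fin_two]⟩

variable {K}

lemma eq_smul_add (A : Sl2 K) :
    A = A.1 0 1 • elE K + A.1 0 0 • elH K + A.1 1 0 • elF K := by
  have hA : A.1 1 1 = - A.1 0 0 := by
    have := LinearMap.mem_ker.1 A.2
    rw [Matrix.traceLinearMap_apply, Matrix.trace_fin_two] at this
    linear_combination this
  apply Subtype.ext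
  change A.1 = A.1 0 1 • !![0, 1; 0, 0] + A.1 0 0 • !![1, 0; 0, -1] + A.1 1 0 • !![0, 0; 1, 0]
  ext i j
  fin_cases i <;> fin_cases j <;> simp [hA]

-- Gives access to the theory of primitive vectors. The triple is later used through `.symm`, which
-- exchanges `e₊` and `e₋` and negates `h`, so that a primitive vector of weight `d` is a lowest
-- weight vector of weight `-d`.
variable (K) in
lemma isSl2Triple : IsSl2Triple (elH K) (elE K) (elF K) where
  h_ne_zero h := by
    have := congr_fun (congr_fun (congr_arg Subtype.val h) 0) 0
    simp [elH] at this
  lie_e_f := by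
    apply Subtype.ext
    rw [LieAlgebra.SpecialLinear.sl_bracket]
    ext i j
    fin_cases i <;> fin_cases j <;> simp [elE, elF, elH]
  lie_h_e_nsmul := by
    apply Subtype.ext
    rw [LieAlgebra.SpecialLinear.sl_bracket, two_smul]
    change _ = (elE K).1 + (elE K).1
    ext i j
    fin_cases i <;> fin_cases j <;> simp [elE, elH, one_add_one_eq_two]
  lie_h_f_nsmul := by
    apply Subtype.ext
    rw [LieAlgebra.SpecialLinear.sl_bracket, two_smul]
    change _ = -((elF K).1 + (elF K).1)
    ext i j
    fin_cases i <;> fin_cases j <;> simp [elF, elH]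
    ring

variable {M N : Type*} [AddCommGroup M] [Module K M] [LieRingModule (Sl2 K) M]
  [LieModule K (Sl2 K) M] [AddCommGroup N] [Module K N] [LieRingModule (Sl2 K) N]
  [LieModule K (Sl2 K) N]

lemma lie_eq (A : Sl2 K) (m : M) :
    ⁅A, m⁆ = A.1 0 1 • ⁅elE K, m⁆ + A.1 0 0 • ⁅elH K, m⁆ + A.1 1 0 • ⁅elF K, m⁆ := by
  conv_lhs => rw [eq_smul_add A]
  simp only [add_lie, smul_lie]

/-- A linear map commuting with `e₊`, `h` and `e₋` is a morphism of `sl₂`-modules. -/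
def homOfTriple (φ : M →ₗ[K] N) (he : ∀ m, φ ⁅elE K, m⁆ = ⁅elE K, φ m⁆)
    (hh : ∀ m, φ ⁅elH K, m⁆ = ⁅elH K, φ m⁆) (hf : ∀ m, φ ⁅elF K, m⁆ = ⁅elF K, φ m⁆) :
    M →ₗ⁅K, Sl2 K⁆ N where
  __ := φ
  map_lie' {A m} := by
    change φ ⁅A, m⁆ = ⁅A, φ m⁆
    rw [lie_eq, lie_eq A (φ m)]
    simp only [map_add, map_smul, he, hh, hf]

end Triple

/-! ### Morphisms out of `V_d` -/

namespace V

variable {K : Type*} [Field K] {d : ℕ}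

lemma lie_def (A : Sl2 K) (v : V K d) :
    ⁅A, v⁆ = A.1 0 1 • e K d v + A.1 0 0 • h K d v + A.1 1 0 • f K d v := rfl

lemma lie_elE (v : V K d) : ⁅elE K, v⁆ = e K d v := by simp [lie_def, elE]

lemma lie_elH (v : V K d) : ⁅elH K, v⁆ = h K d v := by simp [lie_def, elH]

lemma lie_elF (v : V K d) : ⁅elF K, v⁆ = f K d v := by simp [lie_def, elF]

instance : Module.Finite K (V K d) := Module.Finite.of_basis (basis K d)

lemma finrank_eq : Module.finrank K (V K d) = d + 1 := by
  rw [Module.finrank_eq_card_basis (basis K d), Fintype.card_fin]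

lemma f_pow_vec {k j : ℕ} (hj : j < k) : (f K d ^ k) (vec K d j) = 0 := by
  induction k generalizing j with
  | zero => omega
  | succ k ih =>
    rw [pow_succ, Module.End.mul_apply]
    by_cases hd : j < d + 1
    · rw [f_vec K d hd, map_smul]
      cases j with
      | zero => simp
      | succ j => rw [Nat.add_sub_cancel, ih (by omega), smul_zero]
    · rw [vec_of_lt K d (by omega), map_zero, map_zero]

lemma f_pow_eq_zero {k : ℕ} (hk : d < k) : f K d ^ k = 0 :=
  (basis K d).ext fun i => by
    rw [basis_eq, f_pow_vec (by omega), LinearMap.zero_apply]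

lemma repr_f (v : V K d) (j : ℕ) (hj : j + 1 < d + 1) :
    (basis K d).repr (f K d v) ⟨j, by omega⟩ = ((j : K) + 1) * (basis K d).repr v ⟨j + 1, hj⟩ := by
  have : (basis K d).coord ⟨j, by omega⟩ ∘ₗ f K d =
      ((j : K) + 1) • (basis K d).coord ⟨j + 1, hj⟩ := by
    refine (basis K d).ext fun ⟨i, hi⟩ => ?_
    rw [LinearMap.comp_apply, LinearMap.smul_apply, Module.Basis.coord_apply,
      Module.Basis.coord_apply, Module.Basis.repr_self, basis_eq, f_vec K d hi,
      map_smul]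
    cases i with
    | zero => simp
    | succ i =>
      rw [Nat.add_sub_cancel, ← basis_eq K d ⟨i, by omega⟩, Module.Basis.repr_self]
      by_cases h : i = j
      · simp [h]
      · simp [h]
  exact DFunLike.congr_fun this v

/-- The coefficient of `f v` at `v_j` is `j + 1` times that of `v` at `v_{j+1}`, and `j + 1` is
invertible in characteristic `0`. -/
lemma eq_smul_vec_zero [CharZero K] {v : V K d} (hv : f K d v = 0) :
    v = (basis K d).repr v 0 • vec K d 0 := by
  refine (basis K d).repr.injective (Finsupp.ext fun ⟨j, hj⟩ => ?_)
  have h0 : vec K d 0 = basis K d 0 := (basis_eq K d 0).symm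
  rw [map_smul, h0, Module.Basis.repr_self]
  cases j with
  | zero => simp
  | succ j =>
    have := repr_f v j hj
    rw [hv, map_zero, Finsupp.zero_apply, eq_comm, mul_eq_zero] at this
    rw [this.resolve_left (by exact_mod_cast j.succ_ne_zero)]
    simp [Fin.ext_iff]

variable {M : Type*} [AddCommGroup M] [Module K M] [LieRingModule (Sl2 K) M]
  [LieModule K (Sl2 K) M]

/-- The linear map `V_d → M` sending `v_k` to `((d - k)! / d!) e₊ ^ k w`. -/
def ofLowestAux (d : ℕ) (w : M) : V K d →ₗ[K] M :=
  (basis K d).constr K fun k =>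
    -- The scalar is forced by `e₊ ^ k v_0 = (d! / (d - k)!) v_k` in `V_d`.
    (((d - k).factorial : K) / (d.factorial : K)) • (LieModule.toEnd K (Sl2 K) M (elE K) ^ (k : ℕ)) w

lemma ofLowestAux_vec (w : M) {k : ℕ} (hk : k < d + 1) :
    ofLowestAux d w (vec K d k) = (((d - k).factorial : K) / (d.factorial : K)) •
      (LieModule.toEnd K (Sl2 K) M (elE K) ^ k) w := by
  rw [← basis_eq K d ⟨k, hk⟩, ofLowestAux, Module.Basis.constr_basis]

variable [CharZero K] [Module.Finite K M]

/-- The morphism `V_d → M` sending `v_0` to a given lowest weight vector of weight `-d`. -/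
def ofLowest (d : ℕ) (w : M) (hw : (isSl2Triple K).symm.HasPrimitiveVectorWith w (d : K)) :
    V K d →ₗ⁅K, Sl2 K⁆ M :=
  homOfTriple (ofLowestAux d w)
    (fun v => by
      rw [lie_elE]
      have : ofLowestAux d w ∘ₗ e K d =
          LieModule.toEnd K (Sl2 K) M (elE K) ∘ₗ ofLowestAux d w := by
        refine (basis K d).ext fun ⟨k, hk⟩ => ?_
        simp only [LinearMap.comp_apply, basis_eq, e_vec, map_smul, ofLowestAux_vec w hk]
        rw [← Module.End.mul_apply, ← pow_succ']
        by_cases hd : k = d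
        · subst hd
          -- At the top vector one needs `e₊ ^ (d + 1) w = 0`; this is where finite-dimensionality
          -- of `M` enters.
          rw [hw.pow_toEnd_f_eq_zero_of_eq_nat rfl]
          simp
        · rw [ofLowestAux_vec w (by omega), smul_smul]
          congr 1
          obtain ⟨t, rfl⟩ : ∃ t, d = k + t + 1 := ⟨d - k - 1, by omega⟩
          rw [show k + t + 1 - k = t + 1 by omega, show k + t + 1 - (k + 1) = t by omega,
            Nat.factorial_succ t]
          push_cast
          ring
      exact DFunLike.congr_fun this v)
    (fun v => by
      rw [lie_elH]
      have : ofLowestAux d w ∘ₗ h K d =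
          LieModule.toEnd K (Sl2 K) M (elH K) ∘ₗ ofLowestAux d w := by
        refine (basis K d).ext fun ⟨k, hk⟩ => ?_
        simp only [LinearMap.comp_apply, basis_eq, h_vec, map_smul, ofLowestAux_vec w hk]
        -- The flipped triple has `-h` as its middle element, whence the change of sign.
        have := hw.lie_h_pow_toEnd_f k
        rw [neg_lie, neg_eq_iff_eq_neg] at this
        rw [LieModule.toEnd_apply_apply, this]
        module
      exact DFunLike.congr_fun this v)
    (fun v => by
      rw [lie_elF]
      have : ofLowestAux d w ∘ₗ f K d =
          LieModule.toEnd K (Sl2 K) M (elF K) ∘ₗ ofLowestAux d w := by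
        refine (basis K d).ext fun ⟨k, hk⟩ => ?_
        simp only [LinearMap.comp_apply, basis_eq, f_vec K d hk, map_smul, ofLowestAux_vec w hk]
        rw [LieModule.toEnd_apply_apply]
        cases k with
        | zero => simp [hw.lie_e]
        | succ k =>
          -- Here `e₋ e₊ ^ (k + 1) w = (k + 1) (d - k) e₊ ^ k w`, and the factor `d - k` is absorbed
          -- by the factorials.
          rw [hw.lie_e_pow_succ_toEnd_f, Nat.add_sub_cancel, ofLowestAux_vec w (by omega),
            smul_smul, smul_smul]
          congr 1
          obtain ⟨t, rfl⟩ : ∃ t, d = k + t + 1 := ⟨d - k - 1, by omega⟩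
          rw [show k + t + 1 - k = t + 1 by omega, show k + t + 1 - (k + 1) = t by omega,
            Nat.factorial_succ t]
          push_cast
          ring
      exact DFunLike.congr_fun this v)

lemma ofLowest_vec_zero (w : M)
    (hw : (isSl2Triple K).symm.HasPrimitiveVectorWith w (d : K)) :
    ofLowest d w hw (vec K d 0) = w := by
  change ofLowestAux d w (vec K d 0) = w
  rw [ofLowestAux_vec w d.succ_pos, Nat.sub_zero,
    div_self (Nat.cast_ne_zero.2 d.factorial_ne_zero), one_smul, pow_zero, Module.End.one_apply]

end V

/-! ### Morphisms out of finite direct sums of Lie modules -/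

section SumHom

variable {R L ι N : Type*} [CommRing R] [LieRing L] [LieAlgebra R L] [Fintype ι]
  {M : ι → Type*} [∀ i, AddCommGroup (M i)] [∀ i, Module R (M i)] [∀ i, LieRingModule L (M i)]
  [∀ i, LieModule R L (M i)] [AddCommGroup N] [Module R N] [LieRingModule L N] [LieModule R L N]

/-- The morphism out of a finite direct sum of Lie modules given by its components. -/
def sumHom (g : ∀ i, M i →ₗ⁅R, L⁆ N) : (⨁ i, M i) →ₗ⁅R, L⁆ N where
  __ := ∑ i, (g i : M i →ₗ[R] N) ∘ₗ DirectSum.component R ι M i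
  map_lie' {x m} := by
    change (∑ i, (g i : M i →ₗ[R] N) ∘ₗ DirectSum.component R ι M i) ⁅x, m⁆ =
      ⁅x, (∑ i, (g i : M i →ₗ[R] N) ∘ₗ DirectSum.component R ι M i) m⁆
    rw [LinearMap.sum_apply, LinearMap.sum_apply, lie_sum]
    exact Finset.sum_congr rfl fun i _ =>
      (congr_arg (g i) (DirectSum.lie_module_bracket_apply x m i)).trans (g i).map_lie'

omit [LieAlgebra R L] [∀ i, LieModule R L (M i)] [LieModule R L N] in
lemma sumHom_apply (g : ∀ i, M i →ₗ⁅R, L⁆ N) (x : ⨁ i, M i) :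
    sumHom g x = ∑ i, g i (x i) := by
  change (∑ i, (g i : M i →ₗ[R] N) ∘ₗ DirectSum.component R ι M i) x = _
  rw [LinearMap.sum_apply]
  rfl

/-- A bijective morphism of Lie modules is an equivalence. -/
def equivOfBijective {P : Type*} [AddCommGroup P] [Module R P] [LieRingModule L P]
    [LieModule R L P] (φ : P →ₗ⁅R, L⁆ N) (hφ : Function.Bijective φ) : P ≃ₗ⁅R, L⁆ N where
  __ := φ
  invFun := (Equiv.ofBijective φ hφ).symm
  left_inv := (Equiv.ofBijective φ hφ).left_inv
  right_inv := (Equiv.ofBijective φ hφ).right_inv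

end SumHom

/-! ### Weight spaces and decomposition into the `V_i` -/

section Decomposition

variable {K M : Type*} [Field K] [AddCommGroup M] [Module K M]
  [LieRingModule (Sl2 K) M] [LieModule K (Sl2 K) M]

variable (K M) in
/-- The space of vectors of weight `w`. -/
def weightSpace (w : ℤ) : Submodule K M :=
  (LieModule.toEnd K (Sl2 K) M (elH K)).eigenspace (w : K)

lemma mem_weightSpace {w : ℤ} {x : M} : x ∈ weightSpace K M w ↔ ⁅elH K, x⁆ = (w : K) • x := by
  rw [weightSpace, Module.End.mem_eigenspace_iff, LieModule.toEnd_apply_apply]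

lemma lie_elF_mem {w : ℤ} {x : M} (hx : x ∈ weightSpace K M w) :
    ⁅elF K, x⁆ ∈ weightSpace K M (w - 2) := by
  rw [mem_weightSpace] at hx ⊢
  rw [leibniz_lie, (isSl2Triple K).lie_lie_smul_f K, hx, lie_smul, neg_lie, smul_lie]
  push_cast
  module

variable (K M) in
/-- The action of `e₋` from one weight space to the next. -/
def lowering (w : ℤ) : weightSpace K M w →ₗ[K] weightSpace K M (w - 2) :=
  (LieModule.toEnd K (Sl2 K) M (elF K)).restrict fun _ hx => lie_elF_mem hx

lemma toEnd_elF_pow_apply {N : ℕ} {c : ℕ → ℕ} (k : ℕ)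
    (x : ⨁ i : Fin (N + 1), ⨁ _ : Fin (c i), V K i)
    (i : Fin (N + 1)) (b : Fin (c i)) :
    ((LieModule.toEnd K (Sl2 K) _ (elF K) ^ k) x) i b = (V.f K i ^ k) (x i b) := by
  induction k with
  | zero => rfl
  | succ k ih =>
    rw [pow_succ', pow_succ', Module.End.mul_apply, Module.End.mul_apply,
      LieModule.toEnd_apply_apply, DirectSum.lie_module_bracket_apply,
      DirectSum.lie_module_bracket_apply, ih, V.lie_elF]

section Injective

variable [CharZero K] [Module.Finite K M] {N : ℕ} {c : ℕ → ℕ} {w : ∀ i : Fin (N + 1), Fin (c i) → M}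
  (hw : ∀ i b, (isSl2Triple K).symm.HasPrimitiveVectorWith (w i b) ((i : ℕ) : K))

variable (c) in
/-- The morphism from a direct sum of copies of the `V_i` determined by lowest weight vectors. -/
def ofLowests : (⨁ i : Fin (N + 1), ⨁ _ : Fin (c i), V K i) →ₗ⁅K, Sl2 K⁆ M :=
  sumHom fun i => sumHom fun b => V.ofLowest i (w i b) (hw i b)

/-- The kernel is stable under `e₋`, which is nilpotent on the source. A nonzero kernel would
therefore contain a nonzero vector killed by `e₋`, that is, a combination of the vectors `v_0` of
the summands; its image is the same combination of the `w i b`. Independence is needed only for each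
fixed `i`, since different `i` have different weights. -/
lemma ofLowests_injective (hli : ∀ i, LinearIndependent K (w i)) :
    Function.Injective (ofLowests c hw) := by
  rw [injective_iff_map_eq_zero]
  intro x hx
  by_contra hx0
  set T := LieModule.toEnd K (Sl2 K) (⨁ i : Fin (N + 1), ⨁ _ : Fin (c i), V K i) (elF K) with hT
  have hTN : (T ^ (N + 1)) x = 0 := by
    refine DFinsupp.ext fun i => DFinsupp.ext fun b => ?_
    exact (toEnd_elF_pow_apply _ x i b).trans
      (by rw [V.f_pow_eq_zero (by omega), LinearMap.zero_apply]; rfl)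
  -- The last power of `e₋` that does not kill `x`.
  obtain ⟨k, hk, hk'⟩ := Nat.exists_not_and_succ_of_not_zero_of_exists
    (p := fun k => (T ^ k) x = 0) (by simpa using hx0) ⟨_, hTN⟩
  have hy : ofLowests c hw ((T ^ k) x) = 0 := by
    clear hk hk'
    induction k with
    | zero => simpa using hx
    | succ k ih =>
      rw [pow_succ', Module.End.mul_apply, hT, LieModule.toEnd_apply_apply, LieModuleHom.map_lie,
        ← hT, ih, lie_zero]
  set y := (T ^ k) x with hydef
  have hfy (i : Fin (N + 1)) (b : Fin (c i)) : V.f K i (y i b) = 0 := by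
    rw [← V.lie_elF, ← DirectSum.lie_module_bracket_apply, ← DirectSum.lie_module_bracket_apply,
      ← LieModule.toEnd_apply_apply (R := K), ← hT, hydef, ← Module.End.mul_apply, ← pow_succ', hk']
    rfl
  set a : ∀ i : Fin (N + 1), Fin (c i) → K := fun i b => (V.basis K i).repr (y i b) 0 with ha
  have hya (i : Fin (N + 1)) (b : Fin (c i)) : y i b = a i b • V.vec K i 0 :=
    V.eq_smul_vec_zero (hfy i b)
  have hsum : ∑ i, ∑ b, a i b • w i b = 0 := by
    rw [← hy, ofLowests, sumHom_apply]
    refine Finset.sum_congr rfl fun i _ => ?_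
    rw [sumHom_apply]
    refine Finset.sum_congr rfl fun b _ => ?_
    rw [hya, map_smul, V.ofLowest_vec_zero]
  -- Eigenspaces of `-h` for distinct eigenvalues are independent, so the relation splits according
  -- to `i`.
  have hind : iSupIndep fun i : Fin (N + 1) =>
      (LieModule.toEnd K (Sl2 K) M (-elH K)).eigenspace ((i : ℕ) : K) :=
    (LieModule.toEnd K (Sl2 K) M (-elH K)).eigenspaces_iSupIndep.comp
      (f := fun i : Fin (N + 1) => ((i : ℕ) : K))
      fun i j hij => Fin.ext (Nat.cast_injective hij)
  rw [iSupIndep_iff_finsetSum_eq_zero_imp_eq_zero] at hind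
  have hz (i : Fin (N + 1)) : ∑ b, a i b • w i b = 0 := by
    refine hind Finset.univ _ (fun i _ => Submodule.sum_mem _ fun b _ =>
      Submodule.smul_mem _ _ ?_) hsum i (Finset.mem_univ i)
    rw [Module.End.mem_eigenspace_iff, LieModule.toEnd_apply_apply]
    exact (hw i b).lie_h
  apply hk
  refine DFinsupp.ext fun i => DFinsupp.ext fun b => ?_
  have := Fintype.linearIndependent_iff.1 (hli i) (a i) (hz i) b
  exact (hya i b).trans (by rw [this, zero_smul]; rfl)

end Injective

/-! ### Weight multiplicities and the dimension count -/

variable {ι : Type*} [Fintype ι]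

lemma finrank_weightSpace [CharZero K] (b : Module.Basis ι K M) (wt : ι → ℤ)
    (hb : ∀ s, ⁅elH K, b s⁆ = (wt s : K) • b s) (w : ℤ) :
    Module.finrank K (weightSpace K M w) = (Finset.univ.filter fun s => wt s = w).card := by
  have hspan : weightSpace K M w = Submodule.span K (Set.range fun s : {s // wt s = w} => b s) := by
    apply le_antisymm
    · intro x hx
      have hr : Set.range (fun s : {s // wt s = w} => b s) = b '' {s | wt s = w} := by
        ext; simp
      rw [hr, Module.Basis.mem_span_image]
      intro s hs
      -- The coordinate functional at `s` is an eigenvector of the transpose of `h`; comparing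
      -- eigenvalues, a vector of weight `w` has nonzero coordinates only where `wt s = w`.
      have hcoord : b.coord s ∘ₗ LieModule.toEnd K (Sl2 K) M (elH K) = (wt s : K) • b.coord s := by
        classical
        refine b.ext fun t => ?_
        by_cases hst : t = s
        · subst hst; simp [hb]
        · simp [hb, hst]
      have h1 := DFunLike.congr_fun hcoord x
      rw [LinearMap.comp_apply, LieModule.toEnd_apply_apply, mem_weightSpace.1 hx, map_smul,
        LinearMap.smul_apply, smul_eq_mul, smul_eq_mul] at h1
      exact_mod_cast (mul_right_cancel₀ (Finsupp.mem_support_iff.1 hs) h1).symm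
    · rw [Submodule.span_le]
      rintro _ ⟨⟨s, hs⟩, rfl⟩
      change b s ∈ weightSpace K M w
      rw [mem_weightSpace, hb, hs]
  rw [hspan, ← Fintype.card_subtype]
  exact finrank_span_eq_card (b.linearIndependent.comp _ Subtype.val_injective)

/-- The dimension count for symmetric weight multiplicities. -/
lemma sum_sub_mul_eq {A : ℤ → ℤ} {N : ℕ} (hsymm : ∀ w, A (-w) = A w)
    (hA : ∀ w : ℤ, (N : ℤ) < w → A w = 0) :
    ∑ i : Fin (N + 1), (A (-(i : ℕ)) - A (-(i : ℕ) - 2)) * ((i : ℕ) + 1) =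
      ∑ w ∈ Finset.Icc (-N : ℤ) N, A w := by
  -- Summation by parts, with the boundary terms kept so that induction on `T` goes through; they
  -- vanish at `T = N`.
  have key (T : ℕ) :
      ∑ i ∈ Finset.range (T + 1), (A (-(i : ℕ)) - A (-(i : ℕ) - 2)) * ((i : ℤ) + 1) =
        ∑ w ∈ Finset.Icc (-T : ℤ) T, A w - T * A (T + 1) - (T + 1) * A (T + 2) := by
    induction T with
    | zero => simp [← hsymm 2]
    | succ T ih =>
      have hIcc : Finset.Icc (-(T + 1 : ℕ) : ℤ) (T + 1 : ℕ) =
          insert (-(T + 1 : ℤ)) (insert (T + 1 : ℤ) (Finset.Icc (-T : ℤ) T)) := by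
        ext w
        simp only [Finset.mem_insert, Finset.mem_Icc]
        omega
      rw [Finset.sum_range_succ, ih, hIcc, Finset.sum_insert (by simp; omega),
        Finset.sum_insert (by simp), hsymm (T + 1)]
      have h1 : A (-(T + 1 : ℕ)) = A (T + 1) := by rw [hsymm]; push_cast; rfl
      have h2 : A (-(T + 1 : ℕ) - 2) = A (T + 1 + 2) := by
        rw [← hsymm (T + 1 + 2)]; congr 1
      rw [h1, h2]
      push_cast
      rw [show (T : ℤ) + 1 + 1 = T + 2 by ring]
      ring
  rw [Fin.sum_univ_eq_sum_range (fun i : ℕ => (A (-(i : ℕ)) - A (-(i : ℕ) - 2)) * ((i : ℤ) + 1)),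
    key, hA _ (by omega), hA _ (by omega)]
  ring

/-- A finite-dimensional `sl₂`-module on which `h` is diagonalizable with integral eigenvalues of
symmetric multiplicities is a direct sum of the `V_i`, the multiplicity of `V_i` being the difference
of the multiplicities of the weights `-i` and `-i - 2`. -/
theorem decomposition [CharZero K] (b : Module.Basis ι K M) (wt : ι → ℤ)
    (hb : ∀ s, ⁅elH K, b s⁆ = (wt s : K) • b s)
    {N : ℕ} (hN : ∀ s, wt s ≤ N)
    (hsymm : ∀ w, (Finset.univ.filter fun s => wt s = -w).card =
      (Finset.univ.filter fun s => wt s = w).card) {c : ℕ → ℤ}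
    (hc : ∀ i, c i = ((Finset.univ.filter fun s => wt s = -i).card : ℤ) -
      (Finset.univ.filter fun s => wt s = -i - 2).card) :
    (∀ i ≤ N, 0 ≤ c i) ∧
    Nonempty (M ≃ₗ⁅K, Sl2 K⁆ ⨁ i : Fin (N + 1), ⨁ _ : Fin (c i).toNat, V K i) := by
  have : Module.Finite K M := Module.Finite.of_basis b
  -- Rank-nullity for `e₋ : M_{-i} → M_{-i-2}`; for negative `c i` the family is empty.
  have hex (i : Fin (N + 1)) : ∃ w : Fin (c i).toNat → LinearMap.ker (lowering K M (-(i : ℕ))),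
      LinearIndependent K w := by
    apply exists_linearIndependent_of_le_finrank
    have h1 := LinearMap.finrank_range_add_finrank_ker (lowering K M (-(i : ℕ)))
    have h2 := Submodule.finrank_le (LinearMap.range (lowering K M (-(i : ℕ))))
    rw [finrank_weightSpace b wt hb] at h1 h2
    have := hc i
    omega
  choose w₀ hw₀ using hex
  let w (i : Fin (N + 1)) (j : Fin (c i).toNat) : M := (w₀ i j).1.1
  have hli (i) : LinearIndependent K (w i) :=
    ((hw₀ i).map' (Submodule.subtype _) (Submodule.ker_subtype _)).map' (Submodule.subtype _)
      (Submodule.ker_subtype _)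
  have hw (i j) : (isSl2Triple K).symm.HasPrimitiveVectorWith (w i j) ((i : ℕ) : K) :=
    { ne_zero := (hli i).ne_zero j
      lie_h := by
        rw [neg_lie, mem_weightSpace.1 (w₀ i j).1.2]
        push_cast
        module
      lie_e := congr_arg Subtype.val (LinearMap.mem_ker.1 (w₀ i j).2) }
  have hinj := ofLowests_injective (c := fun i => (c i).toNat) hw hli
  have hfin : Module.finrank K (⨁ i : Fin (N + 1), ⨁ _ : Fin (c i).toNat, V K i) =
      ∑ i : Fin (N + 1), (c i).toNat * ((i : ℕ) + 1) := by
    simp [V.finrank_eq]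
  have hM : (Module.finrank K M : ℤ) = ∑ i : Fin (N + 1), c i * ((i : ℕ) + 1) := by
    -- By symmetry some basis vector has weight `-wt s`, to which the upper bound applies.
    have hN' (s) : -N ≤ wt s := by
      have hmem : s ∈ Finset.univ.filter fun t => wt t = wt s := by simp
      have := Finset.card_pos.2 ⟨s, hmem⟩
      rw [← hsymm, Finset.card_pos] at this
      obtain ⟨t, ht⟩ := this
      have h1 := (Finset.mem_filter.1 ht).2
      have h2 := hN t
      omega
    rw [Module.finrank_eq_card_basis b, ← Finset.card_univ,
      Finset.card_eq_sum_card_fiberwise (f := wt) (t := Finset.Icc (-N : ℤ) N)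
        (fun s _ => Finset.mem_coe.2 (Finset.mem_Icc.2 ⟨hN' s, hN s⟩))]
    push_cast
    rw [← sum_sub_mul_eq (A := fun w => ((Finset.univ.filter fun s => wt s = w).card : ℤ))
      (fun w => by rw [hsymm w])
      (fun w hw => by
        rw [Nat.cast_eq_zero, Finset.card_eq_zero, Finset.filter_eq_empty_iff]
        intro s _ h
        have := hN s
        omega)]
    exact Finset.sum_congr rfl fun i _ => by rw [hc]
  have hle := LinearMap.finrank_le_finrank_of_injective
    (f := (ofLowests (fun i => (c i).toNat) hw).toLinearMap) hinj
  rw [hfin] at hle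
  have hle' : ∑ i : Fin (N + 1), ((c i).toNat : ℤ) * ((i : ℕ) + 1) ≤
      ∑ i : Fin (N + 1), c i * ((i : ℕ) + 1) := by
    rw [← hM]
    exact_mod_cast hle
  -- Termwise this inequality is opposite to the one that injectivity gives for the sums, so each
  -- term is an equality: `c i = (c i).toNat`.
  have hterm (i : Fin (N + 1)) : c i * ((i : ℕ) + 1) ≤ ((c i).toNat : ℤ) * ((i : ℕ) + 1) :=
    mul_le_mul_of_nonneg_right (Int.self_le_toNat _) (by positivity)
  have heq := (Finset.sum_eq_sum_iff_of_le fun i _ => hterm i).1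
    (le_antisymm (Finset.sum_le_sum fun i _ => hterm i) hle')
  have hrank : Module.finrank K (⨁ i : Fin (N + 1), ⨁ _ : Fin (c i).toNat, V K i) =
      Module.finrank K M := by
    rw [hfin, ← Int.natCast_inj, hM, Finset.sum_congr rfl heq]
    push_cast
    rfl
  refine ⟨fun i hi => ?_, ⟨(equivOfBijective (ofLowests (fun i => (c i).toNat) hw)
    ⟨hinj, ?_⟩).symm⟩⟩
  · have := mul_right_cancel₀ (by positivity) (heq ⟨i, by omega⟩ (Finset.mem_univ _))
    simp only at this
    omega
  · exact (LinearMap.injective_iff_surjective_of_finrank_eq_finrank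
      (f := (ofLowests (fun i => (c i).toNat) hw).toLinearMap) hrank).1 hinj

end Decomposition

/-! ### Multisets of indices and partitions in a box -/

section Box

variable {n d : ℕ}

/-- The sum of the elements of a multiset of indices. -/
def idxSum (s : Sym (Fin (d + 1)) n) : ℕ := ((s : Multiset (Fin (d + 1))).map Fin.val).sum

/-- The weight of the monomial `∏ v_i` over a multiset of indices. -/
def wt (s : Sym (Fin (d + 1)) n) : ℤ := 2 * idxSum s - (n * d : ℕ)

lemma idxSum_rev_add (s : Sym (Fin (d + 1)) n) : idxSum (s.map Fin.rev) + idxSum s = n * d := by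
  have h (m : Multiset (Fin (d + 1))) :
      (m.map (Fin.val ∘ Fin.rev)).sum + (m.map Fin.val).sum = m.card * d := by
    induction m using Multiset.induction with
    | empty => simp
    | cons a m ih =>
      rw [Multiset.map_cons, Multiset.map_cons, Multiset.sum_cons, Multiset.sum_cons,
        Multiset.card_cons, add_mul, ← ih, Function.comp_apply, Fin.val_rev]
      have := a.2
      omega
  rw [idxSum, idxSum, Sym.coe_map, Multiset.map_map, h, Sym.card_coe]

lemma wt_rev (s : Sym (Fin (d + 1)) n) : wt (s.map Fin.rev) = -wt s := by
  have := idxSum_rev_add s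
  simp only [wt]
  omega

lemma wt_le (s : Sym (Fin (d + 1)) n) : wt s ≤ (n * d : ℕ) := by
  have := idxSum_rev_add s
  simp only [wt]
  omega

/-- The involution `i ↦ d - i` negates weights; on partitions it is complementation in the box. -/
lemma card_wt_neg (w : ℤ) :
    (Finset.univ.filter fun s : Sym (Fin (d + 1)) n => wt s = -w).card =
      (Finset.univ.filter fun s : Sym (Fin (d + 1)) n => wt s = w).card := by
  have hinv (s : Sym (Fin (d + 1)) n) : (s.map Fin.rev).map Fin.rev = s := by
    rw [Sym.map_map, Fin.rev_involutive.comp_self, Sym.map_id]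
  refine Finset.card_nbij' (Sym.map Fin.rev) (Sym.map Fin.rev) ?_ ?_ (fun s _ => hinv s)
    (fun s _ => hinv s)
  all_goals
    intro s hs
    simp only [Finset.coe_filter, Finset.mem_univ, true_and, Set.mem_ofPred_eq] at hs ⊢
    rw [wt_rev, hs]
  rw [neg_neg]

/-- The cardinality recovers the number of zeros, which a partition forgets. -/
lemma multiset_eq_of_filter_ne_zero {A B : Multiset ℕ} (hc : A.card = B.card)
    (h : A.filter (· ≠ 0) = B.filter (· ≠ 0)) : A = B := by
  have hz (C : Multiset ℕ) :
      C = C.filter (· ≠ 0) + Multiset.replicate (C.card - (C.filter (· ≠ 0)).card) 0 := by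
    have h1 := Multiset.filter_add_not (· ≠ 0) C
    simp only [ne_eq, not_not] at h1
    rw [Multiset.filter_eq'] at h1
    have h2 := congr_arg Multiset.card h1
    rw [Multiset.card_add, Multiset.card_replicate] at h2
    conv_lhs => rw [← h1]
    congr 2
    simp only [ne_eq]
    omega
  rw [hz A, hz B, hc, h]

/-- Deleting zeros is a bijection; its inverse pads a partition with zeros up to `n` entries. -/
lemma card_idxSum (k : ℕ) :
    (Finset.univ.filter fun s : Sym (Fin (d + 1)) n => idxSum s = k).card =
      (Finset.univ.filter fun p : Nat.Partition k =>
        p.parts.card ≤ n ∧ ∀ x ∈ p.parts, x ≤ d).card := by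
  refine Finset.card_bij (fun s hs => Nat.Partition.ofSums k
    ((s : Multiset (Fin (d + 1))).map Fin.val) (Finset.mem_filter.1 hs).2) ?_ ?_ ?_
  · intro s hs
    rw [Finset.mem_filter]
    refine ⟨Finset.mem_univ _, ?_, fun x hx => ?_⟩
    · refine (Multiset.card_le_card (Multiset.filter_le _ _)).trans ?_
      rw [Multiset.card_map, Sym.card_coe]
    · obtain ⟨a, -, rfl⟩ := Multiset.mem_map.1 (Multiset.mem_of_mem_filter hx)
      omega
  · intro s hs t ht h
    have := multiset_eq_of_filter_ne_zero (by simp) (congr_arg Nat.Partition.parts h)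
    exact Sym.coe_injective (Multiset.map_injective Fin.val_injective this)
  · intro p hp
    obtain ⟨-, hn, hd⟩ := Finset.mem_filter.1 hp
    set A : Multiset ℕ := p.parts + Multiset.replicate (n - p.parts.card) 0 with hA
    have hAd : ∀ x ∈ A, x < d + 1 := fun x hx => by
      rcases Multiset.mem_add.1 hx with hx | hx
      · exact Nat.lt_succ_of_le (hd x hx)
      · rw [Multiset.eq_of_mem_replicate hx]; omega
    have hmap : (A.pmap (fun x hx => (⟨x, hx⟩ : Fin (d + 1))) hAd).map Fin.val = A := by
      rw [Multiset.map_pmap]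
      exact (Multiset.pmap_eq_map (fun x => x < d + 1) id A hAd).trans A.map_id
    have hcard : (A.pmap (fun x hx => (⟨x, hx⟩ : Fin (d + 1))) hAd).card = n := by
      rw [Multiset.card_pmap, hA, Multiset.card_add, Multiset.card_replicate]
      omega
    refine ⟨⟨_, hcard⟩, ?_, ?_⟩
    · refine Finset.mem_filter.2 ⟨Finset.mem_univ _, ?_⟩
      change ((A.pmap (fun x hx => (⟨x, hx⟩ : Fin (d + 1))) hAd).map Fin.val).sum = k
      rw [hmap, hA]
      simp [p.parts_sum]
    · apply Nat.Partition.ext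
      change ((A.pmap (fun x hx => (⟨x, hx⟩ : Fin (d + 1))) hAd).map Fin.val).filter (· ≠ 0) = _
      rw [hmap, hA, Multiset.filter_add, Multiset.filter_eq_self.2, Multiset.filter_eq_nil.2,
        add_zero]
      · intro x hx
        simp [Multiset.eq_of_mem_replicate hx]
      · exact fun x hx => (p.parts_pos hx).ne'

/-- Weight `w` means sum `q = (n d + w) / 2`. If `q` is not a natural number, both sides are `0`. -/
lemma boxPartitions_eq (w : ℤ) {q : ℚ} (hq : 2 * q = n * d + w) :
    boxPartitions d n q = (Finset.univ.filter fun s : Sym (Fin (d + 1)) n => wt s = w).card := by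
  have hw (s : Sym (Fin (d + 1)) n) : wt s = w ↔ q = idxSum s := by
    rw [wt, ← Int.cast_inj (α := ℚ)]
    push_cast
    constructor <;> intro h <;> linarith
  simp only [hw]
  rw [boxPartitions]
  split_ifs with h
  · rw [← card_idxSum]
    congr 1
    refine Finset.filter_congr fun s _ => ?_
    constructor
    · intro hs; rw [hs]; exact h
    · intro hs; rw [hs, Nat.floor_natCast]
  · symm
    rw [Finset.card_eq_zero, Finset.filter_eq_empty_iff]
    intro s _ hs
    rw [hs, Nat.floor_natCast] at h
    exact h rfl

variable (n d) in
lemma c_eq (i : ℕ) :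
    c n d i = ((Finset.univ.filter fun s : Sym (Fin (d + 1)) n => wt s = -i).card : ℤ) -
      (Finset.univ.filter fun s : Sym (Fin (d + 1)) n => wt s = -i - 2).card := by
  rw [c, boxPartitions_eq (-i) (by push_cast; ring), boxPartitions_eq (-i - 2) (by push_cast; ring)]

/-- The multiset of values of a tuple of indices. -/
def symOf (m : Fin n → Fin (d + 1)) : Sym (Fin (d + 1)) n :=
  ⟨Finset.univ.val.map m, by simp⟩

lemma coe_symOf (m : Fin n → Fin (d + 1)) :
    (symOf m : Multiset (Fin (d + 1))) = Finset.univ.val.map m := rfl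

lemma symOf_surjective : Function.Surjective (symOf : (Fin n → Fin (d + 1)) → _) := by
  rintro ⟨s, rfl⟩
  induction s using Quotient.inductionOn with
  | h l =>
    refine ⟨l.get, Sym.coe_injective ?_⟩
    exact (Fin.univ_val_map l.get).trans (congr_arg _ (List.ofFn_get l))

/-- Equal multisets mean fibres of equal size, and bijections between the fibres glue to a
permutation. -/
lemma exists_perm_of_symOf_eq {m m' : Fin n → Fin (d + 1)} (h : symOf m = symOf m') :
    ∃ σ : Equiv.Perm (Fin n), m' ∘ σ = m := by
  have hm : Finset.univ.val.map m = Finset.univ.val.map m' := congr_arg Sym.toMultiset h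
  have hc (a : Fin (d + 1)) : Nonempty ({i // m i = a} ≃ {i // m' i = a}) := by
    refine ⟨Fintype.equivOfCardEq ?_⟩
    have := congr_arg (Multiset.count a) hm
    rw [Multiset.count_map, Multiset.count_map] at this
    simp only [Fintype.card_subtype, Finset.card_def, Finset.filter_val]
    simpa only [eq_comm] using this
  refine ⟨Equiv.ofFiberEquiv fun a => (hc a).some, funext fun i => ?_⟩
  exact Equiv.ofFiberEquiv_map _ i

lemma symOf_comp_perm (m : Fin n → Fin (d + 1)) (σ : Equiv.Perm (Fin n)) :
    symOf (m ∘ σ) = symOf m := by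
  apply Sym.coe_injective
  rw [coe_symOf, coe_symOf, ← Multiset.map_map, Multiset.map_univ_val_equiv]

lemma idxSum_symOf (m : Fin n → Fin (d + 1)) : idxSum (symOf m) = ∑ k, (m k : ℕ) := by
  rw [idxSum, coe_symOf, Multiset.map_map]
  rfl

end Box

/-! ### Monomial bases -/

section Monomials

variable {K : Type*} [Field K] {n d : ℕ}

/-- The decomposition of a module with a basis of the same weights as `Sym^n (V_d)`. -/
theorem decomposition_of_basis [CharZero K] {M : Type*} [AddCommGroup M] [Module K M]
    [LieRingModule (Sl2 K) M] [LieModule K (Sl2 K) M]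
    (b : Module.Basis (Sym (Fin (d + 1)) n) K M)
    (hb : ∀ s, ⁅elH K, b s⁆ = (wt s : K) • b s) :
    (∀ i ≤ n * d, 0 ≤ c n d i) ∧
    Nonempty (M ≃ₗ⁅K, Sl2 K⁆
      ⨁ i : Fin (n * d + 1), ⨁ _ : Fin (c n d i).toNat, V K i) :=
  decomposition b wt hb wt_le card_wt_neg (c_eq n d)

/-! ### The monomial basis of `Sym^n(V_d)` -/

open SymmetricAlgebra in
/-- The product of the `v_i` over a multiset of indices. -/
def symMonomial (K : Type*) [Field K] (m : Multiset (Fin (d + 1))) :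
    SymmetricAlgebra K (V K d) :=
  (m.map fun i => ι K (V K d) (V.basis K d i)).prod

lemma equivMvPolynomial_symMonomial (m : Multiset (Fin (d + 1))) :
    SymmetricAlgebra.equivMvPolynomial (V.basis K d) (symMonomial K m) =
      MvPolynomial.monomial (Multiset.toFinsupp m) 1 := by
  induction m using Multiset.induction with
  | empty => simp [symMonomial]
  | cons a m ih =>
    rw [symMonomial] at ih ⊢
    rw [Multiset.map_cons, Multiset.prod_cons, map_mul, ih,
      SymmetricAlgebra.equivMvPolynomial_ι_apply, MvPolynomial.X, MvPolynomial.monomial_mul,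
      ← Multiset.singleton_add, map_add, Multiset.toFinsupp_singleton, one_mul]

/-- Since `h` acts as a derivation, the weights `2 i - d` of the factors add up. -/
lemma lie_elH_symMonomial (m : Multiset (Fin (d + 1))) :
    ⁅elH K, symMonomial K m⁆ =
      ((2 * (m.map Fin.val).sum - m.card * d : ℤ) : K) • symMonomial K m := by
  induction m using Multiset.induction with
  | empty => simp [symMonomial, lie_symmetricAlgebra]
  | cons a m ih =>
    rw [symMonomial, lie_symmetricAlgebra] at ih ⊢
    rw [Multiset.map_cons, Multiset.prod_cons, Derivation.leibniz, ih, symDer_ι,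
      LieModule.toEnd_apply_apply, V.lie_elH, V.basis_eq, V.h_vec, ← V.basis_eq, map_smul]
    simp only [smul_eq_mul, mul_smul_comm, Multiset.map_cons, Multiset.sum_cons,
      Multiset.card_cons]
    rw [mul_comm (Multiset.prod _)]
    push_cast
    module

/-- The basis of `V_d` identifies the symmetric algebra with a polynomial ring, where distinct
multisets become distinct monomials. -/
lemma linearIndependent_symMonomial :
    LinearIndependent K fun s : Sym (Fin (d + 1)) n => symMonomial K (s : Multiset (Fin (d + 1))) := by
  have h := (MvPolynomial.basisMonomials (Fin (d + 1)) K).linearIndependent.comp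
    (fun s : Sym (Fin (d + 1)) n => Multiset.toFinsupp (s : Multiset (Fin (d + 1))))
    fun s t hst => Sym.coe_injective (Multiset.toFinsupp.injective hst)
  refine LinearIndependent.of_comp
    (SymmetricAlgebra.equivMvPolynomial (V.basis K d)).toLinearMap ?_
  have heq : (SymmetricAlgebra.equivMvPolynomial (V.basis K d)).toLinearMap ∘
      (fun s : Sym (Fin (d + 1)) n => symMonomial K (s : Multiset (Fin (d + 1)))) =
      MvPolynomial.basisMonomials (Fin (d + 1)) K ∘
        fun s : Sym (Fin (d + 1)) n => Multiset.toFinsupp (s : Multiset (Fin (d + 1))) :=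
    funext fun s => (equivMvPolynomial_symMonomial _).trans
      (by rw [Function.comp_apply, MvPolynomial.coe_basisMonomials])
  rw [heq]
  exact h

/-- The `n`-th power of a span is spanned by `n`-fold products of the generators, and by
commutativity such a product depends only on the multiset of its factors. -/
lemma span_symMonomial :
    Submodule.span K (Set.range fun s : Sym (Fin (d + 1)) n =>
      symMonomial K (s : Multiset (Fin (d + 1)))) =
      (symPower K (V K d) (Sl2 K) n).toSubmodule := by
  change _ = (LinearMap.range (SymmetricAlgebra.ι K (V K d))) ^ n
  rw [LinearMap.range_eq_map, ← (V.basis K d).span_eq, Submodule.map_span, Submodule.span_pow]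
  congr 1
  ext x
  rw [Set.mem_pow_iff_prod]
  constructor
  · rintro ⟨s, rfl⟩
    obtain ⟨m, rfl⟩ := symOf_surjective s
    refine ⟨fun i => SymmetricAlgebra.ι K _ (V.basis K d (m i)),
      fun i => ⟨_, ⟨m i, rfl⟩, rfl⟩, ?_⟩
    simp only [symMonomial, coe_symOf, Multiset.map_map]
    rfl
  · rintro ⟨g, hg, rfl⟩
    choose v hv hvg using hg
    choose m hm using hv
    refine ⟨symOf m, ?_⟩
    simp only [symMonomial, coe_symOf, Multiset.map_map, ← hvg, ← hm]
    rfl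

theorem symPower_decomposition [CharZero K] :
    Nonempty (symPower K (V K d) (Sl2 K) n ≃ₗ⁅K, Sl2 K⁆
      ⨁ i : Fin (n * d + 1), ⨁ _ : Fin (c n d i).toNat, V K i) := by
  let b : Module.Basis (Sym (Fin (d + 1)) n) K (symPower K (V K d) (Sl2 K) n) :=
    (Module.Basis.span linearIndependent_symMonomial).map
      (LinearEquiv.ofEq _ _ span_symMonomial)
  refine (decomposition_of_basis b fun s => Subtype.ext ?_).2
  have hbs : (b s : SymmetricAlgebra K (V K d)) = symMonomial K (s : Multiset (Fin (d + 1))) := by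
    rw [Module.Basis.map_apply, LinearEquiv.coe_ofEq_apply, Module.Basis.span_apply]
  change ⁅elH K, (b s : SymmetricAlgebra K (V K d))⁆ = (wt s : K) • (b s : SymmetricAlgebra K (V K d))
  rw [hbs, lie_elH_symMonomial, Sym.card_coe, wt, idxSum]
  push_cast
  rfl

/-! ### The monomial symmetric basis of `Λ_n^{(d)}` -/

open MvPolynomial

/-- The exponent vector of the monomial `∏ x_k ^ (m k)`. -/
def expo (m : Fin n → Fin (d + 1)) : Fin n →₀ ℕ :=
  Finsupp.equivFunOnFinite.symm fun k => (m k : ℕ)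

lemma expo_apply (m : Fin n → Fin (d + 1)) (k : Fin n) : expo m k = m k := rfl

lemma expo_injective : Function.Injective (expo : (Fin n → Fin (d + 1)) → _) := by
  intro m m' h
  exact funext fun k => Fin.ext (DFunLike.congr_fun h k)

lemma mapDomain_expo (m : Fin n → Fin (d + 1)) (σ : Equiv.Perm (Fin n)) :
    (expo m).mapDomain σ = expo (m ∘ σ.symm) := by
  ext k
  rw [Finsupp.mapDomain_equiv_apply]
  rfl

variable (K) in
/-- The monomial symmetric polynomial of a multiset of exponents. -/
def monSym (s : Sym (Fin (d + 1)) n) : MvPolynomial (Fin n) K :=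
  -- The sum runs over distinct rearrangements, not over permutations, so every coefficient is `0`
  -- or `1`.
  ∑ m : Fin n → Fin (d + 1) with symOf m = s, monomial (expo m) 1

lemma coeff_monSym (s : Sym (Fin (d + 1)) n) (m : Fin n → Fin (d + 1)) :
    coeff (expo m) (monSym K s) = if symOf m = s then 1 else 0 := by
  simp [monSym, coeff_sum, coeff_monomial, expo_injective.eq_iff, Finset.sum_ite_eq']

lemma coeff_monSym_of_notMem_range (s : Sym (Fin (d + 1)) n) {e : Fin n →₀ ℕ}
    (he : e ∉ Set.range (expo : (Fin n → Fin (d + 1)) → _)) : coeff e (monSym K s) = 0 := by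
  rw [monSym, coeff_sum]
  refine Finset.sum_eq_zero fun m _ => ?_
  rw [coeff_monomial, if_neg fun h => he ⟨m, h⟩]

lemma monSym_mem (s : Sym (Fin (d + 1)) n) : monSym K s ∈ symPolySubmodule K n d := by
  refine ⟨fun σ => ?_, fun i => ?_⟩
  · rw [monSym, map_sum]
    refine Finset.sum_nbij' (fun m => m ∘ σ.symm) (fun m => m ∘ σ) ?_ ?_ ?_ ?_ ?_
    · intro m hm
      simpa [symOf_comp_perm] using hm
    · intro m hm
      simpa [symOf_comp_perm] using hm
    · intro m _
      ext; simp
    · intro m _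
      ext; simp
    · intro m _
      rw [rename_monomial, mapDomain_expo]
  · rw [monSym]
    refine (degreeOf_sum_le i _ _).trans (Finset.sup_le fun m _ =>
      degreeOf_monomial_le (fun _ j => ?_) i)
    rw [expo_apply]
    omega

/-- Coefficients of a symmetric polynomial are constant on permutation orbits of exponents, which
are the fibres of `symOf`. -/
lemma coeff_expo_eq {p : MvPolynomial (Fin n) K} (hp : p.IsSymmetric)
    {m m' : Fin n → Fin (d + 1)} (h : symOf m = symOf m') :
    coeff (expo m) p = coeff (expo m') p := by
  obtain ⟨σ, rfl⟩ := exists_perm_of_symOf_eq h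
  have := coeff_rename_mapDomain σ.symm σ.symm.injective p (expo m')
  rwa [hp, mapDomain_expo, Equiv.symm_symm] at this

lemma eq_sum_monSym {p : MvPolynomial (Fin n) K} (hp : p ∈ symPolySubmodule K n d) :
    p = ∑ s : Sym (Fin (d + 1)) n,
      coeff (expo (Function.surjInv symOf_surjective s)) p • monSym K s := by
  ext e
  rw [coeff_sum]
  simp only [coeff_smul, smul_eq_mul]
  by_cases he : e ∈ Set.range (expo : (Fin n → Fin (d + 1)) → _)
  · obtain ⟨m, rfl⟩ := he
    simp only [coeff_monSym, mul_ite, mul_one, mul_zero, Finset.sum_ite_eq, Finset.mem_univ,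
      if_true]
    exact coeff_expo_eq hp.1 (Function.surjInv_eq symOf_surjective _).symm
  · simp only [coeff_monSym_of_notMem_range _ he, mul_zero, Finset.sum_const_zero]
    -- An exponent that occurs in `p` has entries at most `d`, hence lies in the range of `expo`.
    by_contra hne
    refine he ⟨fun k => ⟨e k, ?_⟩, ?_⟩
    · exact Nat.lt_succ_of_le ((monomial_le_degreeOf k (mem_support_iff.2 hne)).trans (hp.2 k))
    · ext k
      rfl

lemma linearIndependent_monSym :
    LinearIndependent K (monSym K : Sym (Fin (d + 1)) n → MvPolynomial (Fin n) K) := by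
  rw [Fintype.linearIndependent_iff]
  intro g hg s
  obtain ⟨m, rfl⟩ := symOf_surjective s
  have := congr_arg (coeff (expo m)) hg
  simpa [coeff_sum, coeff_smul, coeff_monSym] using this

lemma span_monSym :
    Submodule.span K (Set.range (monSym K : Sym (Fin (d + 1)) n → MvPolynomial (Fin n) K)) =
      symPolySubmodule K n d := by
  apply le_antisymm
  · rw [Submodule.span_le]
    rintro _ ⟨s, rfl⟩
    exact monSym_mem s
  · intro p hp
    rw [eq_sum_monSym hp]
    exact Submodule.sum_mem _ fun s _ =>
      Submodule.smul_mem _ _ (Submodule.subset_span ⟨s, rfl⟩)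

lemma polyH_monSym (s : Sym (Fin (d + 1)) n) :
    polyH K n d (monSym K s) = (wt s : K) • monSym K s := by
  rw [monSym, map_sum, Finset.smul_sum]
  refine Finset.sum_congr rfl fun m hm => ?_
  rw [polyH_monomial, ← (Finset.mem_filter.1 hm).2, wt, idxSum_symOf]
  simp [expo_apply]

theorem symPoly_decomposition [CharZero K] :
    (∀ i ≤ n * d, 0 ≤ c n d i) ∧
    Nonempty (symPoly K n d ≃ₗ⁅K, Sl2 K⁆
      ⨁ i : Fin (n * d + 1), ⨁ _ : Fin (c n d i).toNat, V K i) := by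
  let b : Module.Basis (Sym (Fin (d + 1)) n) K (symPoly K n d) :=
    (Module.Basis.span linearIndependent_monSym).map (LinearEquiv.ofEq _ _ span_monSym)
  refine decomposition_of_basis b fun s => Subtype.ext ?_
  have hbs : (b s : Poly K n d) = monSym K s :=
    congr_arg Subtype.val (Module.Basis.span_apply (linearIndependent_monSym (K := K)) s)
  -- The coefficients `0, 1, 0` are the matrix entries of `elH` by which `sl2Rep` weights the three
  -- operators.
  change ((0 : K) • polyE K n d (b s).1 + (1 : K) • polyH K n d (b s).1 +
    (0 : K) • polyF K n (b s).1 : MvPolynomial (Fin n) K) = (wt s : K) • (b s).1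
  rw [hbs, zero_smul, zero_smul, one_smul, zero_add, add_zero, polyH_monSym]
  rfl

end Monomials

end SlTwo

end

theorem mainTheorem4 (K : Type*) [Field K] [CharZero K] (n d : ℕ) :
    Nonempty (SlTwo.symPoly K n d ≃ₗ⁅K, SlTwo.Sl2 K⁆
      SlTwo.symPower K (SlTwo.V K d) (SlTwo.Sl2 K) n) ∧
    (∀ i ≤ n * d, 0 ≤ SlTwo.c n d i) ∧
    Nonempty (SlTwo.symPoly K n d ≃ₗ⁅K, SlTwo.Sl2 K⁆
      ⨁ i : Fin (n * d + 1), ⨁ _ : Fin (SlTwo.c n d i).toNat, SlTwo.V K i) := by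
  obtain ⟨hc, ⟨φ⟩⟩ := SlTwo.symPoly_decomposition (K := K) (n := n) (d := d)
  obtain ⟨ψ⟩ := SlTwo.symPower_decomposition (K := K) (n := n) (d := d)
  exact ⟨⟨φ.trans ψ.symm⟩, hc, ⟨φ⟩⟩
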